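/- Let $K$ be an algebraically closed field of any characteristic, and let $S\subseteq\mathbb N^d$ be the semigroup (containing $0$) generated by $\mathbf m_1,\dots,\mathbf m_n\in\mathbb N^d$. The toric ideal $I_S\subseteq K[x_1,\dots,x_n]$ is the ideal generated by all binomials $\mathbf x^{\mathbf b}-\mathbf x^{\mathbf c}$ with $\sum_i b_i\mathbf m_i=\sum_i c_i\mathbf m_i$, and the affine toric variety $V_S\subseteq\mathbb A^n$ is its zero set in $K^n$ (it depends on the chosen list of generators). Let $\ell$ be a positive integer and let $\mathbf m\in S$ be such that $\ell$ is relatively prime to some component of $\mathbf m$. Let $S_{\ell,\mathbf m}$ be the semigroup generated by $\ell\mathbf m_1,\dots,\ell\mathbf m_n,\mathbf m$, and let $V_{S_{\ell,\mathbf m}}\subseteq\mathbb A^{n+1}$ be the affine toric variety defined in the same way by these $n+1$ generators; it is called an extension of $V_S$. A variety $V\subseteq\mathbb A^N$ is called a set-theoretic complete intersection if it is the common zero set of $N-\dim V$ polynomials, and arithmetically Cohen–Macaulay (respectively Gorenstein) if its coordinate ring $K[x_1,\dots,x_N]/I(V)$ is a Cohen–Macaulay (respectively Gorenstein) ring. Then: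 1. if $V_S$ is a set-theoretic complete intersection, so is $V_{S_{\ell,\mathbf m}}$; 2. if $V_S$ is arithmetically Cohen–Macaulay, so is $V_{S_{\ell,\mathbf m}}$; 3. if $V_S$ is Gorenstein, so is $V_{S_{\ell,\mathbf m}}$. -/

import Mathlib

namespace ToricExtension

section CommutativeAlgebra

universe u

/-- The depth of a local ring: the supremum of the lengths of the regular sequences
contained in its maximal ideal. -/
noncomputable def localDepth (R : Type u) [CommRing R] [IsLocalRing R] : ℕ∞ :=
  ⨆ rs : {rs : List R // RingTheory.Sequence.IsRegular R rs ∧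
    ∀ r ∈ rs, r ∈ IsLocalRing.maximalIdeal R}, (rs.1.length : ℕ∞)

/-- A Cohen–Macaulay ring: a Noetherian ring all of whose localizations at prime ideals
have depth equal to their Krull dimension. -/
def IsCohenMacaulayRing (R : Type u) [CommRing R] : Prop :=
  IsNoetherianRing R ∧
    ∀ (p : Ideal R) [p.IsPrime],
      (localDepth (Localization.AtPrime p) : WithBot ℕ∞) =
        ringKrullDim (Localization.AtPrime p)

/-- A Gorenstein ring: a Noetherian ring all of whose localizations at prime ideals
have finite injective dimension as modules over themselves. -/
def IsGorensteinRing (R : Type u) [CommRing R] : Prop :=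
  IsNoetherianRing R ∧
    ∀ (p : Ideal R) [p.IsPrime], ∃ k : ℕ,
      CategoryTheory.HasInjectiveDimensionLE
        (ModuleCat.of (Localization.AtPrime p) (Localization.AtPrime p)) k

end CommutativeAlgebra

section Varieties

variable {K : Type*} [Field K] {n : ℕ}

/-- The coordinate ring `K[x₁,…,xₙ] / I(V)` of a subset `V` of affine `n`-space. -/
abbrev CoordinateRing (V : Set (Fin n → K)) : Type _ :=
  MvPolynomial (Fin n) K ⧸ MvPolynomial.vanishingIdeal K V

/-- `V ⊆ 𝔸ⁿ` is a set-theoretic complete intersection: it is the common zero set of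
`r = n - dim V` polynomials, where `dim V` is the Krull dimension of the coordinate ring. -/
def IsSetTheoreticCompleteIntersection (V : Set (Fin n → K)) : Prop :=
  ∃ (r : ℕ) (f : Fin r → MvPolynomial (Fin n) K),
    (r : WithBot ℕ∞) + ringKrullDim (CoordinateRing V) = (n : WithBot ℕ∞) ∧
      V = {x | ∀ i, MvPolynomial.eval x (f i) = 0}

/-- `V ⊆ 𝔸ⁿ` is arithmetically Cohen–Macaulay: its coordinate ring is Cohen–Macaulay. -/
def IsArithmeticallyCohenMacaulay (V : Set (Fin n → K)) : Prop :=
  IsCohenMacaulayRing (CoordinateRing V)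

/-- `V ⊆ 𝔸ⁿ` is (arithmetically) Gorenstein: its coordinate ring is Gorenstein. -/
def IsArithmeticallyGorenstein (V : Set (Fin n → K)) : Prop :=
  IsGorensteinRing (CoordinateRing V)

end Varieties

section Toric

variable {n d : ℕ}

/-- The subsemigroup `S` (with zero) of `ℕᵈ` generated by the vectors `a₁,…,aₙ`. -/
def semigroup (a : Fin n → Fin d → ℕ) : AddSubmonoid (Fin d → ℕ) :=
  AddSubmonoid.closure (Set.range a)

/-- The `S`-degree `b₁ a₁ + ⋯ + bₙ aₙ` of the monomial with exponent vector `b`. -/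
def sDegree (a : Fin n → Fin d → ℕ) (b : Fin n →₀ ℕ) : Fin d → ℕ :=
  ∑ i, b i • a i

/-- The toric ideal: generated by all binomials `x^b - x^c` whose two monomials have the same
`S`-degree. -/
noncomputable def toricIdeal (K : Type*) [Field K] (a : Fin n → Fin d → ℕ) :
    Ideal (MvPolynomial (Fin n) K) :=
  Ideal.span {p | ∃ b c : Fin n →₀ ℕ, sDegree a b = sDegree a c ∧
    p = MvPolynomial.monomial b 1 - MvPolynomial.monomial c 1}

/-- The affine toric variety in `𝔸ⁿ`: the zero set of the toric ideal. -/
def toricVariety (K : Type*) [Field K] (a : Fin n → Fin d → ℕ) : Set (Fin n → K) :=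
  MvPolynomial.zeroLocus K (toricIdeal K a)

/-- The generators `ℓ a₁, …, ℓ aₙ, m` of the semigroup `S_{ℓ,m}`. -/
def extGenerators (a : Fin n → Fin d → ℕ) (l : ℕ) (m : Fin d → ℕ) :
    Fin (n + 1) → Fin d → ℕ :=
  Fin.snoc (α := fun _ => Fin d → ℕ) (fun i => l • a i) m

/-- The toric variety of `S_{ℓ,m}` is an extension of the toric variety of `S`: `m ∈ S`, and `ℓ`
is a positive integer relatively prime to some component of `m`. -/
def IsExtension (a : Fin n → Fin d → ℕ) (l : ℕ) (m : Fin d → ℕ) : Prop :=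
  m ∈ semigroup a ∧ 0 < l ∧ ∃ j, Nat.Coprime l (m j)

end Toric

end ToricExtension

open CategoryTheory

universe u

section IntegralExtensions

variable {A B : Type*} [CommRing A] [CommRing B] [Algebra A B]

theorem PrimeSpectrum.strictMono_comap_of_isIntegral [Algebra.IsIntegral A B] :
    StrictMono (PrimeSpectrum.comap (algebraMap A B)) := fun _ _ h ↦
  Ideal.IsIntegral.comap_lt_comap (R := A) h

/-- Contraction of primes along an integral ring extension does not decrease the height. -/
theorem Ideal.height_le_height_under_of_isIntegral [Algebra.IsIntegral A B] (Q : Ideal B)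
    [Q.IsPrime] : Q.height ≤ (Q.under A).height := by
  rw [PrimeSpectrum.height_eq_orderHeight ⟨Q, ‹_›⟩,
    PrimeSpectrum.height_eq_orderHeight ⟨Q.under A, inferInstance⟩]
  exact Order.height_le_height_apply_of_strictMono _
    (PrimeSpectrum.strictMono_comap_of_isIntegral (A := A)) _

/-- A faithfully flat integral extension of Noetherian rings preserves the Krull dimension. -/
theorem ringKrullDim_eq_of_isIntegral_of_faithfullyFlat [IsNoetherianRing A] [IsNoetherianRing B]
    [Algebra.IsIntegral A B] [Module.FaithfullyFlat A B] : ringKrullDim B = ringKrullDim A := by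
  refine le_antisymm
    (Order.krullDim_le_of_strictMono _ (PrimeSpectrum.strictMono_comap_of_isIntegral (A := A))) ?_
  rw [ringKrullDim_le_iff_height_le]
  intro p hp
  obtain ⟨⟨Q, hQ⟩, h⟩ := PrimeSpectrum.comap_surjective_of_faithfullyFlat (B := B) ⟨p, hp⟩
  have : Q.LiesOver p := ⟨(congrArg PrimeSpectrum.asIdeal h).symm⟩
  refine le_trans ?_ (Ideal.height_le_ringKrullDim_of_isPrime (I := Q))
  rw [Ideal.height_eq_height_add_of_liesOver_of_hasGoingDown p Q]
  exact_mod_cast le_self_add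

end IntegralExtensions

namespace ToricExtension

theorem localDepth_le_ringKrullDim (R : Type u) [CommRing R] [IsLocalRing R]
    [IsNoetherianRing R] : (localDepth R : WithBot ℕ∞) ≤ ringKrullDim R := by
  obtain ⟨d, hd⟩ := WithBot.ne_bot_iff_exists.mp (ringKrullDim_ne_bot (R := R))
  rw [← hd, localDepth]
  refine WithBot.coe_le_coe.mpr (iSup_le fun rs ↦ WithBot.coe_le_coe.mp ?_)
  rw [hd, ← ringKrullDim_add_length_eq_ringKrullDim_of_isRegular rs.1 rs.2.1]
  have : Nontrivial (R ⧸ Ideal.ofList rs.1) := by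
    refine Ideal.Quotient.nontrivial_iff.mpr fun h ↦ rs.2.1.2 ?_
    simp [h]
  exact le_add_of_nonneg_left ringKrullDim_nonneg_of_nontrivial

/-- Depth does not decrease along a flat local homomorphism. -/
theorem localDepth_le_of_flat (R S : Type u) [CommRing R] [CommRing S] [IsLocalRing R]
    [IsLocalRing S] [Algebra R S] [Module.Flat R S] [IsLocalHom (algebraMap R S)] :
    localDepth R ≤ localDepth S := by
  have : Module.FaithfullyFlat R S := Module.FaithfullyFlat.of_flat_of_isLocalHom
  refine iSup_le fun rs ↦ ?_
  refine le_trans (by simp) (le_iSup (fun rs : {rs : List S // RingTheory.Sequence.IsRegular S rs ∧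
    ∀ r ∈ rs, r ∈ IsLocalRing.maximalIdeal S} ↦ (rs.1.length : ℕ∞))
    ⟨rs.1.map (algebraMap R S), rs.2.1.of_faithfullyFlat, ?_⟩)
  intro r hr
  obtain ⟨x, hx, rfl⟩ := List.mem_map.mp hr
  exact ((IsLocalRing.mem_maximalIdeal _).mpr fun h ↦
    (IsLocalRing.mem_maximalIdeal x).mp (rs.2.2 x hx) (isUnit_of_map_unit (algebraMap R S) x h))

/-- The Cohen–Macaulay property ascends along finite flat extensions. -/
theorem IsCohenMacaulayRing.of_finite_flat {A B : Type u} [CommRing A] [CommRing B] [Algebra A B]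
    [Module.Finite A B] [Module.Flat A B] (hA : IsCohenMacaulayRing A) :
    IsCohenMacaulayRing B := by
  have := hA.1
  have hB : IsNoetherianRing B := IsNoetherianRing.of_finite A B
  refine ⟨hB, fun Q _ ↦ ?_⟩
  let := Localization.AtPrime.algebraOfLiesOver (Q.under A) Q
  have : IsLocalHom (algebraMap (Localization.AtPrime (Q.under A)) (Localization.AtPrime Q)) := by
    rw [RingHom.algebraMap_toAlgebra]
    exact Localization.isLocalHom_localRingHom (Q.under A) Q (algebraMap A B) Ideal.LiesOver.over
  refine le_antisymm (localDepth_le_ringKrullDim _) ?_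
  have h := localDepth_le_of_flat (Localization.AtPrime (Q.under A)) (Localization.AtPrime Q)
  refine le_trans ?_ (WithBot.coe_le_coe.mpr h)
  rw [hA.2, IsLocalization.AtPrime.ringKrullDim_eq_height Q,
    IsLocalization.AtPrime.ringKrullDim_eq_height (Q.under A)]
  exact WithBot.coe_le_coe.mpr (Ideal.height_le_height_under_of_isIntegral Q)

end ToricExtension

/-- An exact functor preserving injectives does not increase the injective dimension. -/
theorem CategoryTheory.Functor.hasInjectiveDimensionLE_obj {C D : Type*} [Category C] [Category D]
    [Abelian C] [Abelian D] [EnoughInjectives C] (F : C ⥤ D) [F.PreservesZeroMorphisms]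
    [F.PreservesInjectiveObjects] (hF : ∀ T : ShortComplex C, T.ShortExact → (T.map F).ShortExact)
    (n : ℕ) (M : C) [h : HasInjectiveDimensionLE M n] : HasInjectiveDimensionLE (F.obj M) n := by
  induction n generalizing M with
  | zero =>
    simp only [HasInjectiveDimensionLE, zero_add, ← injective_iff_hasInjectiveDimensionLT_one]
      at h ⊢
    exact F.injective_obj M
  | succ n ih =>
    obtain ⟨I, inj, f, _⟩ := EnoughInjectives.presentation M
    let T := ShortComplex.mk f (Limits.cokernel.π f) (Limits.cokernel.condition f)
    have hT : T.ShortExact := { exact := ShortComplex.exact_cokernel f }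
    have := (hT.hasInjectiveDimensionLT_X₃_iff n inj).mpr h
    exact ((hF T hT).hasInjectiveDimensionLT_X₃_iff n (F.injective_obj I)).mp (ih T.X₃)

namespace ModuleCat

variable {A B : Type u} [CommRing A] [CommRing B] (f : A →+* B)

instance : (coextendScalars.{u, u, u} f).PreservesInjectiveObjects where
  injective_obj {X} _ := Injective.injective_of_adjoint (restrictCoextendScalarsAdj.{u} f) X

instance : (coextendScalars.{u, u, u} f).Additive where
  map_add := rfl

theorem shortExact_map_coextendScalars 
    [Module.Projective A ((restrictScalars f).obj (of B B))]
    (T : ShortComplex (ModuleCat.{u} A)) (hT : T.ShortExact) :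
    (T.map (coextendScalars.{u, u, u} f)).ShortExact := by
  have hex := (ShortComplex.ShortExact.moduleCat_exact_iff_function_exact _).mp hT.exact
  have hinj := hT.moduleCat_injective_f
  have hsurj := hT.moduleCat_surjective_g
  refine shortComplex_shortExact _ ?_ ?_ ?_
  · intro (g : (restrictScalars f).obj (of B B) →ₗ[A] T.X₂)
    constructor
    · intro hg
      choose x hx using fun b ↦ (hex (g b)).mp (LinearMap.congr_fun hg b)
      refine ⟨{ toFun := x, map_add' := fun b c ↦ hinj ?_, map_smul' := fun a b ↦ hinj ?_ },
        LinearMap.ext hx⟩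
      · simp only [map_add, hx]
      · simp only [map_smul, hx, RingHom.id_apply]
    · rintro ⟨(h : (restrictScalars f).obj (of B B) →ₗ[A] T.X₁), rfl⟩
      exact LinearMap.ext fun b ↦ hex.apply_apply_eq_zero (h b)
  · intro (g : (restrictScalars f).obj (of B B) →ₗ[A] T.X₁)
      (g' : (restrictScalars f).obj (of B B) →ₗ[A] T.X₁) h
    exact LinearMap.ext fun b ↦ hinj (LinearMap.congr_fun h b)
  · intro (g : (restrictScalars f).obj (of B B) →ₗ[A] T.X₃)
    obtain ⟨h, hh⟩ := Module.projective_lifting_property T.g.hom g hsurj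
    exact ⟨h, hh⟩

end ModuleCat

section PureExtension

variable {A B : Type u} [CommRing A] [CommRing B] [Algebra A B]

/-- An extension with basis `1, y, …, y ^ (l - 1)` such that `y ^ l` lies in the base ring is
self-dual: it is isomorphic to the module coextended from the base ring. -/
theorem exists_linearEquiv_coextendScalars {l : ℕ} (hl : 0 < l) (y : B) (c : A)
    (hy : y ^ l = algebraMap A B c) (e : Module.Basis (Fin l) A B) (he : ∀ i, e i = y ^ (i : ℕ)) :
    Nonempty (B ≃ₗ[B]
      (ModuleCat.coextendScalars.{u, u, u} (algebraMap A B)).obj (ModuleCat.of A A)) := by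
  let τ : B →ₗ[A] A := e.coord ⟨l - 1, by omega⟩
  have hτ : ∀ i j : Fin l, τ (e i * e j.rev) = if i = j then 1 else 0 := by
    intro i j
    have key : ∀ k (hk : k < l), τ (y ^ k) = if k = l - 1 then 1 else 0 := by
      intro k hk
      have := he ⟨k, hk⟩
      simp only at this
      rw [← this]
      simp [τ, Finsupp.single_apply, Fin.ext_iff]
    rw [he, he, ← pow_add, Fin.val_rev]
    simp only [Fin.ext_iff]
    by_cases h : (i : ℕ) + (l - (j + 1)) < l
    · rw [key _ h]
      congr 1
      simp only [eq_iff_iff]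
      omega
    · obtain ⟨k, hk⟩ := Nat.exists_eq_add_of_le (not_lt.mp h)
      have := i.2
      have := j.2
      rw [hk, pow_add, hy, ← Algebra.smul_def, map_smul, key k (by omega), if_neg (by omega),
        if_neg (by omega), smul_zero]
  have hsum : ∀ (a : Fin l → A) (i : Fin l), τ (e i * ∑ j, a j • e j.rev) = a i := by
    intro a i
    simp [Finset.mul_sum, hτ]
  have hrepr : ∀ (b : B) (i : Fin l), τ (e i * b) = e.repr b i.rev := by
    intro b i
    rw [← hsum (fun j ↦ e.repr b j.rev) i]
    congr 2
    exact (e.sum_repr b).symm.trans (Equiv.sum_comp Fin.revPerm fun j ↦ e.repr b j • e j).symm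
  let W := (ModuleCat.restrictScalars (algebraMap A B)).obj (ModuleCat.of B B)
  let ι : W →ₗ[A] B :=
    { toFun := fun x ↦ x
      map_add' := fun _ _ ↦ rfl
      map_smul' := fun a x ↦ (Algebra.smul_def a _).symm }
  let ι' : B →ₗ[A] W :=
    { toFun := fun x ↦ x
      map_add' := fun _ _ ↦ rfl
      map_smul' := fun a x ↦ Algebra.smul_def (A := B) a x }
  let Φ : B →ₗ[B] (ModuleCat.coextendScalars.{u, u, u} (algebraMap A B)).obj (ModuleCat.of A A) :=
    { toFun := fun b ↦ (τ ∘ₗ LinearMap.mulRight A b ∘ₗ ι : W →ₗ[A] A)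
      map_add' := fun b b' ↦ LinearMap.ext fun (x : B) ↦
        (congrArg τ (mul_add x b b')).trans (map_add τ _ _)
      map_smul' := fun b b' ↦ LinearMap.ext fun (x : B) ↦
        congrArg τ (mul_assoc x b b').symm }
  refine ⟨LinearEquiv.ofBijective Φ ⟨?_, fun (φ : W →ₗ[A] A) ↦ ?_⟩⟩
  · refine (injective_iff_map_eq_zero Φ).mpr fun b hb ↦ e.repr.map_eq_zero_iff.mp ?_
    ext i
    rw [← i.rev_rev, ← hrepr]
    exact LinearMap.congr_fun (show (Φ b : W →ₗ[A] A) = 0 from hb) (ι' (e i.rev))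
  · refine ⟨∑ j, φ (ι' (e j)) • e j.rev, ?_⟩
    have : τ ∘ₗ LinearMap.mulRight A (∑ j, φ (ι' (e j)) • e j.rev) = φ ∘ₗ ι' :=
      e.ext fun i ↦ hsum _ i
    exact LinearMap.ext fun (x : B) ↦ LinearMap.congr_fun this x

theorem hasInjectiveDimensionLE_of_pureExtension {l : ℕ} (hl : 0 < l) (y : B) (c : A)
    (hy : y ^ l = algebraMap A B c) (e : Module.Basis (Fin l) A B) (he : ∀ i, e i = y ^ (i : ℕ))
    (k : ℕ) (hA : HasInjectiveDimensionLE (ModuleCat.of A A) k) :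
    HasInjectiveDimensionLE (ModuleCat.of B B) k := by
  obtain ⟨ε⟩ := exists_linearEquiv_coextendScalars hl y c hy e he
  let W := (ModuleCat.restrictScalars (algebraMap A B)).obj (ModuleCat.of B B)
  let ι : B ≃ₗ[A] W :=
    { toFun := fun x ↦ x
      invFun := fun x ↦ x
      left_inv := fun _ ↦ rfl
      right_inv := fun _ ↦ rfl
      map_add' := fun _ _ ↦ rfl
      map_smul' := fun a x ↦ Algebra.smul_def (A := B) a x }
  have : Module.Projective A W := .of_basis (e.map ι)
  refine (ModuleCat.hasInjectiveDimensionLE_iff_of_linearEquiv (M := ModuleCat.of B B) ε k).mpr ?_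
  exact Functor.hasInjectiveDimensionLE_obj _
    (ModuleCat.shortExact_map_coextendScalars (algebraMap A B)) k (ModuleCat.of A A)

attribute [local instance] RingHomInvPair.of_ringEquiv in
theorem hasInjectiveDimensionLE_self_of_isLocalization [IsNoetherianRing A] (S : Submonoid A)
    [IsLocalization S B] (k : ℕ) (hA : HasInjectiveDimensionLE (ModuleCat.of A A) k) :
    HasInjectiveDimensionLE (ModuleCat.of B B) k := by
  have h := ModuleCat.localizedModule_hasInjectiveDimensionLE k S (ModuleCat.of A A)
  have : IsLocalizedModule S ((ModuleCat.of A A).localizedModuleMkLinearMap S) :=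
    ModuleCat.localizedModule_isLocalizedModule _ S
  let ε : (ModuleCat.of A A).localizedModule S ≃ₗ[Localization S]
      ModuleCat.of (Localization S) (Localization S) :=
    LinearEquiv.extendScalarsOfIsLocalization S (Localization S)
      (IsLocalizedModule.linearEquiv (M := A) S ((ModuleCat.of A A).localizedModuleMkLinearMap S)
        (Algebra.linearMap A (Localization S)))
  rw [ModuleCat.hasInjectiveDimensionLE_iff_of_linearEquiv ε] at h
  let eR : Localization S ≃+* B := (IsLocalization.algEquiv S (Localization S) B).toRingEquiv
  let ε' : ModuleCat.of (Localization S) (Localization S) ≃ₛₗ[RingHomClass.toRingHom eR]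
      ModuleCat.of B B :=
    { eR with map_smul' := fun x z ↦ map_mul eR x z }
  exact (ModuleCat.hasInjectiveDimensionLE_iff_of_semiLinearEquiv eR ε' k).mp h

end PureExtension

namespace ToricExtension

theorem IsGorensteinRing.of_pureExtension {A B : Type u} [CommRing A] [CommRing B] [Algebra A B]
    {l : ℕ} (hl : 0 < l) (y : B) (c : A) (hy : y ^ l = algebraMap A B c)
    (e : Module.Basis (Fin l) A B) (he : ∀ i, e i = y ^ (i : ℕ)) (hA : IsGorensteinRing A) :
    IsGorensteinRing B := by
  have := hA.1
  have : Module.Finite A B := .of_basis e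
  have hB : IsNoetherianRing B := IsNoetherianRing.of_finite A B
  refine ⟨hB, fun q _ ↦ ?_⟩
  let p := q.under A
  obtain ⟨k, hk⟩ := hA.2 p
  let Rp := Localization.AtPrime p
  let Sp := Localization (Algebra.algebraMapSubmonoid B p.primeCompl)
  let Sq := Localization.AtPrime q
  let f : Sp →ₐ[B] Sq := IsLocalization.liftAlgHom (M := Algebra.algebraMapSubmonoid B p.primeCompl)
        (f := Algebra.ofId _ _) (by
      rintro ⟨_, x, hx, rfl⟩
      simpa using! IsLocalization.map_units (M := q.primeCompl) Sq ⟨algebraMap _ _ x,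
        by simp_all [p]⟩)
  algebraize [f.toRingHom]
  have : IsScalarTower B Sp Sq := .of_algebraMap_eq' f.comp_algebraMap.symm
  have : IsLocalization (Algebra.algebraMapSubmonoid Sp q.primeCompl) Sq :=
    .isLocalization_of_submonoid_le _ _ (Algebra.algebraMapSubmonoid B p.primeCompl) _
    (by rintro _ ⟨x, hx, rfl⟩; simp_all [p])
  have : IsNoetherianRing Sp :=
    IsLocalization.isNoetherianRing (Algebra.algebraMapSubmonoid B p.primeCompl) _ hB
  refine ⟨k, hasInjectiveDimensionLE_self_of_isLocalization (A := Sp)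
    (Algebra.algebraMapSubmonoid Sp q.primeCompl) k ?_⟩
  refine hasInjectiveDimensionLE_of_pureExtension (A := Rp) hl (algebraMap B Sp y)
    (algebraMap A Rp c) ?_ (e.localizationLocalization Rp p.primeCompl Sp) ?_ k hk
  · rw [← map_pow, hy, ← IsScalarTower.algebraMap_apply, ← IsScalarTower.algebraMap_apply]
  · intro i
    rw [Module.Basis.localizationLocalization_apply, he, map_pow]

end ToricExtension

namespace ToricExtension

open MvPolynomial

variable {n d : ℕ}

section Parametrization

variable {K : Type*} [Field K]

/-- The monomial parametrization `x_i ↦ t ^ (a i)` of a toric variety, on coordinate rings. -/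
noncomputable def monomialMap (K : Type*) [Field K] (a : Fin n → Fin d → ℕ) :
    MvPolynomial (Fin n) K →ₐ[K] MvPolynomial (Fin d) K :=
  aeval fun i ↦ monomial (Finsupp.equivFunOnFinite.symm (a i)) 1

theorem monomialMap_X (a : Fin n → Fin d → ℕ) (i : Fin n) :
    monomialMap K a (X i) = monomial (Finsupp.equivFunOnFinite.symm (a i)) 1 :=
  aeval_X _ _

theorem monomialMap_monomial (a : Fin n → Fin d → ℕ) (b : Fin n →₀ ℕ) (r : K) :
    monomialMap K a (monomial b r) =
      monomial (Finsupp.equivFunOnFinite.symm (sDegree a b)) r := by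
  rw [monomialMap, aeval_monomial, Finsupp.prod_fintype _ _ (by simp)]
  simp only [monomial_pow, one_pow]
  rw [← monomial_sum_one, algebraMap_eq, C_mul_monomial, mul_one]
  congr 2
  ext j
  simp [sDegree, Finsupp.finsetSum_apply]

theorem ker_monomialMap (a : Fin n → Fin d → ℕ) :
    RingHom.ker (monomialMap K a) = toricIdeal K a := by
  refine le_antisymm (fun p hp ↦ ?_) (Ideal.span_le.mpr ?_)
  · let g : (Fin d →₀ ℕ) → (Fin n →₀ ℕ) :=
      Function.invFun fun b ↦ Finsupp.equivFunOnFinite.symm (sDegree a b)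
    have hg : ∀ b, sDegree a (g (Finsupp.equivFunOnFinite.symm (sDegree a b))) = sDegree a b :=
      fun b ↦ Finsupp.equivFunOnFinite.symm.injective
        (Function.invFun_eq (f := fun b ↦ Finsupp.equivFunOnFinite.symm (sDegree a b)) ⟨b, rfl⟩)
    let ψ : MvPolynomial (Fin d) K →ₗ[K] MvPolynomial (Fin n) K :=
      (basisMonomials (Fin d) K).constr K fun u ↦ monomial (g u) 1
    have hψ : ∀ u r, ψ (monomial u r) = monomial (g u) r := by
      intro u r
      have := (basisMonomials (Fin d) K).constr_basis K (fun u ↦ monomial (g u) (1 : K)) u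
      rw [coe_basisMonomials] at this
      rw [← mul_one r, ← smul_eq_mul, ← smul_monomial, map_smul, this, smul_monomial]
    have key : ∀ q : MvPolynomial (Fin n) K, q - ψ (monomialMap K a q) ∈ toricIdeal K a := by
      intro q
      induction q using MvPolynomial.induction_on' with
      | monomial b r =>
        rw [monomialMap_monomial, hψ, ← mul_one r, ← C_mul_monomial, ← C_mul_monomial, ← mul_sub]
        exact Ideal.mul_mem_left _ _ (Ideal.subset_span ⟨_, _, (hg b).symm, rfl⟩)
      | add p q hp hq =>
        rw [map_add, map_add, add_sub_add_comm]
        exact add_mem hp hq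
    have := key p
    rwa [RingHom.mem_ker.mp hp, map_zero, sub_zero] at this
  · rintro _ ⟨b, c, h, rfl⟩
    rw [SetLike.mem_coe, RingHom.mem_ker, map_sub, monomialMap_monomial, monomialMap_monomial, h,
      sub_self]

instance (a : Fin n → Fin d → ℕ) : (toricIdeal K a).IsPrime :=
  ker_monomialMap (K := K) a ▸ RingHom.ker_isPrime _

theorem vanishingIdeal_toricVariety [IsAlgClosed K] (a : Fin n → Fin d → ℕ) :
    vanishingIdeal K (toricVariety K a) = toricIdeal K a :=
  IsPrime.vanishingIdeal_zeroLocus _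

theorem mem_toricVariety_iff (a : Fin n → Fin d → ℕ) (x : Fin n → K) :
    x ∈ toricVariety K a ↔ ∀ b c : Fin n → ℕ, ∑ i, b i • a i = ∑ i, c i • a i →
      ∏ i, x i ^ b i = ∏ i, x i ^ c i := by
  have hmon : ∀ b : Fin n →₀ ℕ, aeval x (monomial b (1 : K)) = ∏ i, x i ^ b i := fun b ↦ by
    rw [aeval_monomial, map_one, one_mul, Finsupp.prod_fintype _ _ (by simp)]
  rw [toricVariety, toricIdeal, zeroLocus_span]
  constructor
  · intro h b c hbc
    have := h _ ⟨Finsupp.equivFunOnFinite.symm b, Finsupp.equivFunOnFinite.symm c, hbc, rfl⟩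
    rw [map_sub, hmon, hmon, sub_eq_zero] at this
    exact this
  · rintro h _ ⟨b, c, hbc, rfl⟩
    rw [map_sub, hmon, hmon, sub_eq_zero]
    exact h b c hbc

end Parametrization

section Extension

variable {K : Type*} [Field K] (a : Fin n → Fin d → ℕ) (l : ℕ) (m : Fin d → ℕ)

theorem exists_sum_smul_eq_of_mem_semigroup {m : Fin d → ℕ} (hm : m ∈ semigroup a) :
    ∃ s : Fin n → ℕ, ∑ i, s i • a i = m := by
  obtain ⟨s, hs⟩ := AddSubmonoid.mem_closure_range_iff_of_fintype.mp hm
  exact ⟨s, hs.symm⟩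

@[simp]
theorem extGenerators_castSucc (i : Fin n) : extGenerators a l m i.castSucc = l • a i := by
  simp [extGenerators]

@[simp]
theorem extGenerators_last : extGenerators a l m (Fin.last n) = m := by
  simp [extGenerators]

theorem monomialMap_extGenerators_rename (p : MvPolynomial (Fin n) K) :
    monomialMap K (extGenerators a l m) (rename Fin.castSucc p) =
      expand l (monomialMap K a p) := by
  rw [← AlgHom.comp_apply, ← AlgHom.comp_apply]
  congr 1
  ext i : 1
  rw [AlgHom.comp_apply, AlgHom.comp_apply, rename_X, monomialMap_X, monomialMap_X,
    expand_monomial, extGenerators_castSucc]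
  congr 2
  ext k
  simp

/-- If `l` is coprime to some entry of `m`, the translates by `0, m, …, (l - 1) m` of the lattice
`l ℤᵈ` are disjoint; so polynomials in the `l`-th powers of the variables are independent over
the corresponding monomials. -/
theorem eq_zero_of_sum_expand_mul_monomial_eq_zero {l : ℕ} {m : Fin d → ℕ} (hl : 0 < l)
    {j : Fin d} (hj : Nat.Coprime l (m j)) (g : Fin l → MvPolynomial (Fin d) K)
    (h : ∑ i, expand l (g i) *
      monomial ((i : ℕ) • Finsupp.equivFunOnFinite.symm m) (1 : K) = 0) (i : Fin l) :
    g i = 0 := by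
  ext u
  have hc := congrArg (coeff (l • u + (i : ℕ) • Finsupp.equivFunOnFinite.symm m)) h
  rw [coeff_sum, Finset.sum_eq_single i, coeff_mul_monomial, coeff_expand_smul _ hl.ne',
    mul_one] at hc
  · exact hc
  · intro k _ hk
    rw [coeff_mul_monomial']
    split_ifs with hle
    · rw [coeff_expand_of_not_dvd (i := j), zero_mul]
      intro hdvd
      refine hk (Fin.ext (Nat.ModEq.eq_of_lt_of_lt ?_ k.2 i.2))
      have hle' := hle j
      simp only [Finsupp.coe_tsub, Finsupp.coe_add, Finsupp.coe_smul, Pi.sub_apply, Pi.add_apply,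
        Pi.smul_apply, smul_eq_mul, Finsupp.equivFunOnFinite_symm_apply_apply] at hle' hdvd
      have h1 : (k : ℕ) * m j ≡ l * u j + i * m j [MOD l] := (Nat.modEq_iff_dvd' hle').mpr hdvd
      have h2 : l * u j + i * m j ≡ i * m j [MOD l] := by simp [Nat.ModEq]
      exact Nat.ModEq.cancel_right_of_coprime hj (h1.trans h2)
    · rfl
  · simp

theorem sum_smul_smul (b : Fin n → ℕ) : ∑ i, b i • l • a i = l • ∑ i, b i • a i := by
  rw [Finset.smul_sum]
  exact Finset.sum_congr rfl fun i _ ↦ smul_comm _ _ _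

theorem prod_pow_eq_of_mem_toricVariety_extension {s : Fin n → ℕ} {l : ℕ} {m : Fin d → ℕ}
    (hl : 0 < l) (hs : ∑ i, s i • a i = m) {j : Fin d} (hj : Nat.Coprime l (m j))
    {x : Fin n → K} (hx : x ∈ toricVariety K a) {y : K} (hy : y ^ l = ∏ i, x i ^ s i)
    {b c : Fin n → ℕ} {p q : ℕ} (hpq : q ≤ p)
    (h : ∑ i, b i • l • a i + p • m = ∑ i, c i • l • a i + q • m) :
    (∏ i, x i ^ b i) * y ^ p = (∏ i, x i ^ c i) * y ^ q := by
  rw [sum_smul_smul, sum_smul_smul] at h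
  obtain ⟨r, rfl⟩ := Nat.exists_eq_add_of_le hpq
  have h' : l • (∑ i, b i • a i) + r • m = l • ∑ i, c i • a i := by
    rw [add_smul, add_comm (q • m), ← add_assoc] at h
    exact add_right_cancel h
  have hdvd : l ∣ r := by
    refine hj.dvd_of_dvd_mul_right ?_
    have := congrFun h' j
    simp only [Pi.add_apply, Pi.smul_apply, smul_eq_mul] at this
    exact (Nat.dvd_add_right (Dvd.intro _ rfl)).mp (this ▸ Dvd.intro _ rfl)
  obtain ⟨t, rfl⟩ := hdvd
  have h'' : ∑ i, (b i + t * s i) • a i = ∑ i, c i • a i := by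
    have h3 : l • (∑ i, b i • a i + t • m) = l • ∑ i, c i • a i := by
      rw [← h', smul_add, smul_smul]
    have h4 : ∑ i, b i • a i + t • m = ∑ i, c i • a i := by
      ext k
      exact Nat.eq_of_mul_eq_mul_left hl (congrFun h3 k)
    rw [← h4, ← hs, Finset.smul_sum, ← Finset.sum_add_distrib]
    exact Finset.sum_congr rfl fun i _ ↦ by rw [add_smul, mul_smul]
  rw [← (mem_toricVariety_iff a x).mp hx _ _ h'', add_comm q, pow_add, pow_mul, hy,
    ← Finset.prod_pow, ← mul_assoc, ← Finset.prod_mul_distrib]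
  congr 1
  exact Finset.prod_congr rfl fun i _ ↦ by rw [pow_add, ← pow_mul, mul_comm t]

theorem mem_toricVariety_extGenerators_iff {s : Fin n → ℕ} {l : ℕ} {m : Fin d → ℕ}
    (hl : 0 < l) (hs : ∑ i, s i • a i = m) {j : Fin d} (hj : Nat.Coprime l (m j))
    (z : Fin (n + 1) → K) :
    z ∈ toricVariety K (extGenerators a l m) ↔
      (fun i ↦ z (Fin.castSucc i)) ∈ toricVariety K a ∧
        z (Fin.last n) ^ l = ∏ i, z (Fin.castSucc i) ^ s i := by
  constructor
  · intro hz
    rw [mem_toricVariety_iff] at hz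
    constructor
    · rw [mem_toricVariety_iff]
      intro b c hbc
      have := hz (Fin.snoc (α := fun _ ↦ ℕ) b 0) (Fin.snoc (α := fun _ ↦ ℕ) c 0) (by
        simp only [Fin.sum_univ_castSucc, Fin.snoc_castSucc, Fin.snoc_last, extGenerators_castSucc,
          sum_smul_smul, hbc])
      simpa [Fin.prod_univ_castSucc] using this
    · have := hz (Fin.snoc (α := fun _ ↦ ℕ) 0 l) (Fin.snoc (α := fun _ ↦ ℕ) s 0) (by
        simp only [Fin.sum_univ_castSucc, Fin.snoc_castSucc, Fin.snoc_last, extGenerators_castSucc,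
          extGenerators_last, sum_smul_smul, hs, Pi.zero_apply, zero_smul, Finset.sum_const_zero,
          zero_add, add_zero])
      simpa [Fin.prod_univ_castSucc] using this
  · rintro ⟨hx, hy⟩
    rw [mem_toricVariety_iff]
    intro b c hbc
    rw [Fin.sum_univ_castSucc, Fin.sum_univ_castSucc] at hbc
    simp only [extGenerators_castSucc, extGenerators_last] at hbc
    rw [Fin.prod_univ_castSucc, Fin.prod_univ_castSucc]
    rcases le_total (c (Fin.last n)) (b (Fin.last n)) with h | h
    · exact prod_pow_eq_of_mem_toricVariety_extension a hl hs hj hx hy h hbc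
    · exact (prod_pow_eq_of_mem_toricVariety_extension a hl hs hj hx hy h hbc.symm).symm

variable [IsAlgClosed K]

theorem mk_toricVariety_eq_zero_iff {p : MvPolynomial (Fin n) K} :
    (Ideal.Quotient.mk _ p : CoordinateRing (toricVariety K a)) = 0 ↔ monomialMap K a p = 0 := by
  rw [Ideal.Quotient.eq_zero_iff_mem, vanishingIdeal_toricVariety, ← ker_monomialMap,
    RingHom.mem_ker]

/-- The map on coordinate rings of the projection from an extension to the original variety. -/
noncomputable def extensionMap : CoordinateRing (toricVariety K a) →+*
    CoordinateRing (toricVariety K (extGenerators a l m)) :=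
  Ideal.quotientMap _ (rename Fin.castSucc : MvPolynomial (Fin n) K →ₐ[K] _).toRingHom (by
    intro p hp
    rw [← Ideal.Quotient.eq_zero_iff_mem, mk_toricVariety_eq_zero_iff] at hp
    rw [Ideal.mem_comap, ← Ideal.Quotient.eq_zero_iff_mem, mk_toricVariety_eq_zero_iff]
    exact (monomialMap_extGenerators_rename a l m p).trans (by rw [hp, map_zero]))

theorem extensionMap_mk (p : MvPolynomial (Fin n) K) :
    extensionMap a l m (Ideal.Quotient.mk _ p) = Ideal.Quotient.mk _ (rename Fin.castSucc p) :=
  rfl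

/-- The coordinate ring of an extension is obtained from that of the original variety by adjoining
an `l`-th root of the monomial of degree `m`. -/
theorem exists_basis_of_isExtension {l : ℕ} {m : Fin d → ℕ} (h : IsExtension a l m) :
    letI := (extensionMap (K := K) a l m).toAlgebra
    ∃ (y : CoordinateRing (toricVariety K (extGenerators a l m)))
      (c : CoordinateRing (toricVariety K a))
      (e : Module.Basis (Fin l) (CoordinateRing (toricVariety K a))
        (CoordinateRing (toricVariety K (extGenerators a l m)))),
      y ^ l = algebraMap _ _ c ∧ ∀ i, e i = y ^ (i : ℕ) := by
  let := (extensionMap (K := K) a l m).toAlgebra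
  obtain ⟨hm, hl, j, hj⟩ := h
  obtain ⟨s, hs⟩ := exists_sum_smul_eq_of_mem_semigroup a hm
  let A := CoordinateRing (toricVariety K a)
  let B := CoordinateRing (toricVariety K (extGenerators a l m))
  let y : B := Ideal.Quotient.mk _ (X (Fin.last n))
  let c : A := Ideal.Quotient.mk _ (monomial (Finsupp.equivFunOnFinite.symm s) 1)
  have hy : y ^ l = algebraMap A B c := by
    refine Eq.trans ?_ (extensionMap_mk a l m _).symm
    rw [← map_pow, ← sub_eq_zero, ← map_sub, mk_toricVariety_eq_zero_iff, map_sub, map_pow,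
      monomialMap_extGenerators_rename, monomialMap_X, extGenerators_last, monomialMap_monomial,
      expand_monomial, monomial_pow, one_pow, sub_eq_zero]
    rw [show sDegree a (Finsupp.equivFunOnFinite.symm s) = m from hs]
  have hli : LinearIndependent A fun i : Fin l ↦ y ^ (i : ℕ) := by
    rw [Fintype.linearIndependent_iff]
    intro g hg
    choose f hf using fun i ↦ Ideal.Quotient.mk_surjective (g i)
    intro i
    rw [← hf, mk_toricVariety_eq_zero_iff]
    refine eq_zero_of_sum_expand_mul_monomial_eq_zero hl hj (fun i ↦ monomialMap K a (f i)) ?_ i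
    have : (Ideal.Quotient.mk _ (∑ i : Fin l, rename Fin.castSucc (f i) *
        X (Fin.last n) ^ (i : ℕ)) : B) = 0 := by
      rw [← hg, map_sum]
      refine Finset.sum_congr rfl fun i _ ↦ ?_
      rw [map_mul, map_pow, ← extensionMap_mk, hf, Algebra.smul_def]
      rfl
    rw [mk_toricVariety_eq_zero_iff, map_sum] at this
    rw [← this]
    refine Finset.sum_congr rfl fun i _ ↦ ?_
    rw [map_mul, map_pow, monomialMap_extGenerators_rename, monomialMap_X, extGenerators_last,
      monomial_pow, one_pow]
  have hspan : ∀ x : B, x ∈ Submodule.span A (Set.range fun i : Fin l ↦ y ^ (i : ℕ)) := by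
    have hmul : ∀ x ∈ Submodule.span A (Set.range fun i : Fin l ↦ y ^ (i : ℕ)),
        x * y ∈ Submodule.span A (Set.range fun i : Fin l ↦ y ^ (i : ℕ)) := by
      intro x hx
      induction hx using Submodule.span_induction with
      | mem x hx =>
        obtain ⟨i, rfl⟩ := hx
        rw [← pow_succ]
        rcases Nat.lt_or_ge (i + 1) l with hi | hi
        · exact Submodule.subset_span ⟨⟨i + 1, hi⟩, rfl⟩
        · rw [show (i : ℕ) + 1 = l by omega, hy, Algebra.algebraMap_eq_smul_one]
          exact Submodule.smul_mem _ _ (Submodule.subset_span ⟨⟨0, hl⟩, pow_zero y⟩)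
      | zero => rw [zero_mul]; exact zero_mem _
      | add x x' _ _ hx hx' => rw [add_mul]; exact add_mem hx hx'
      | smul r x _ hx => rw [smul_mul_assoc]; exact Submodule.smul_mem _ r hx
    intro x
    obtain ⟨p, rfl⟩ := Ideal.Quotient.mk_surjective x
    induction p using MvPolynomial.induction_on with
    | C r =>
      have : (Ideal.Quotient.mk _ (C r) : B) = (Ideal.Quotient.mk _ (C r) : A) • y ^ 0 := by
        rw [Algebra.smul_def, pow_zero, mul_one]
        exact (congrArg _ (rename_C Fin.castSucc r)).symm
      rw [this]
      exact Submodule.smul_mem _ _ (Submodule.subset_span ⟨⟨0, hl⟩, rfl⟩)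
    | add p q hp hq => rw [map_add]; exact add_mem hp hq
    | mul_X p i hp =>
      rw [map_mul]
      induction i using Fin.lastCases with
      | last => exact hmul _ hp
      | cast i =>
        have : (Ideal.Quotient.mk _ p * Ideal.Quotient.mk _ (X i.castSucc) : B) =
            (Ideal.Quotient.mk _ (X i) : A) • (Ideal.Quotient.mk _ p : B) := by
          rw [Algebra.smul_def, mul_comm]
          exact congrArg (· * _) (congrArg _ (rename_X Fin.castSucc i)).symm
        rw [this]
        exact Submodule.smul_mem _ _ hp
  exact ⟨y, c, Module.Basis.mk hli fun x _ ↦ hspan x, hy, fun i ↦ Module.Basis.mk_apply _ _ i⟩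

end Extension

end ToricExtension

theorem mainTheorem2 (K : Type*) [Field K] [IsAlgClosed K] (n d : ℕ)
    (a : Fin n → Fin d → ℕ) (l : ℕ) (m : Fin d → ℕ)
    (h : ToricExtension.IsExtension a l m) :
    (ToricExtension.IsSetTheoreticCompleteIntersection (ToricExtension.toricVariety K a) →
      ToricExtension.IsSetTheoreticCompleteIntersection
        (ToricExtension.toricVariety K (ToricExtension.extGenerators a l m))) ∧
    (ToricExtension.IsArithmeticallyCohenMacaulay (ToricExtension.toricVariety K a) →
      ToricExtension.IsArithmeticallyCohenMacaulay
        (ToricExtension.toricVariety K (ToricExtension.extGenerators a l m))) ∧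
    (ToricExtension.IsArithmeticallyGorenstein (ToricExtension.toricVariety K a) →
      ToricExtension.IsArithmeticallyGorenstein
        (ToricExtension.toricVariety K (ToricExtension.extGenerators a l m))) := by
  open ToricExtension in
  let := (extensionMap (K := K) a l m).toAlgebra
  obtain ⟨y, c, e, hy, he⟩ := exists_basis_of_isExtension (K := K) a h
  obtain ⟨hm, hl, j, hj⟩ := h
  have : Module.Finite (CoordinateRing (toricVariety K a))
    (CoordinateRing (toricVariety K (extGenerators a l m))) := .of_basis e
  have : Module.Free (CoordinateRing (toricVariety K a))
    (CoordinateRing (toricVariety K (extGenerators a l m))) := .of_basis e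
  refine ⟨?_, IsCohenMacaulayRing.of_finite_flat, IsGorensteinRing.of_pureExtension hl y c hy e he⟩
  rintro ⟨r, f, hr, hV⟩
  obtain ⟨s, hs⟩ := exists_sum_smul_eq_of_mem_semigroup a hm
  refine ⟨r + 1, Fin.snoc (α := fun _ ↦ MvPolynomial (Fin (n + 1)) K)
    (fun i ↦ MvPolynomial.rename Fin.castSucc (f i))
    (MvPolynomial.X (Fin.last n) ^ l - MvPolynomial.rename Fin.castSucc
      (MvPolynomial.monomial (Finsupp.equivFunOnFinite.symm s) 1)), ?_, ?_⟩
  · have : Nontrivial (CoordinateRing (toricVariety K (extGenerators a l m))) := by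
      refine Ideal.Quotient.nontrivial_iff.mpr ?_
      rw [vanishingIdeal_toricVariety]
      exact Ideal.IsPrime.ne_top'
    rw [ringKrullDim_eq_of_isIntegral_of_faithfullyFlat (A := CoordinateRing (toricVariety K a))]
    push_cast
    rw [← hr, add_right_comm]
  · ext z
    rw [mem_toricVariety_extGenerators_iff a hl hs hj, hV]
    simp [Fin.forall_fin_succ', MvPolynomial.eval_rename, sub_eq_zero, MvPolynomial.eval_monomial,
      Finsupp.prod_fintype, Function.comp_def]
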